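/- Let $\mathcal H$ be a complex Hilbert space, $U$ a unitary operator on $\mathcal H$, and $A$ a compact operator on $\mathcal H$. Let $\sigma_{\rm pp}(U)\subset\mathbb T$ be the set of eigenvalues of $U$ and, for $z\in\mathbb T$, let $E_z$ be the orthogonal projection of $\mathcal H$ onto the eigenspace $\{x\in\mathcal H : Ux=zx\}$. Then the net $\sum_{z\in F}E_zAE_z$, indexed by the finite subsets $F$ of $\sigma_{\rm pp}(U)$ directed by inclusion, converges in the strong operator topology to a bounded operator, denoted $\sum_{z\in\sigma_{\rm pp}(U)}E_zAE_z$, and $$\frac1N\sum_{n=0}^{N-1}U^nAU^{-n}\;\longrightarrow\;\sum_{z\in\sigma_{\rm pp}(U)}E_zAE_z\qquad(N\to+\infty)$$ in the weak operator topology. -/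

import Mathlib

open Filter Topology

noncomputable section

namespace UnitaryErgodic

variable {H : Type*} [NormedAddCommGroup H] [InnerProductSpace ℂ H] [CompleteSpace H]

/-- The eigenspace `{x | U x = z x}` of the unitary operator `U` for the point `z` of the
unit circle (it is `{0}` when `z` is not an eigenvalue). -/
def eigenspace (U : unitary (H →L[ℂ] H)) (z : Circle) : Submodule ℂ H :=
  Module.End.eigenspace ((U : H →L[ℂ] H) : Module.End ℂ H) (z : ℂ)

instance completeSpace_eigenspace (U : unitary (H →L[ℂ] H)) (z : Circle) :
    CompleteSpace (eigenspace U z) :=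
  (ContinuousLinearMap.isClosed_eigenspace (f := (U : H →L[ℂ] H)) (z : ℂ)).completeSpace_coe

/-- `E_z`: the selfadjoint (orthogonal) projection of `H` onto the eigenspace of `U` for `z`. -/
def eigenProj (U : unitary (H →L[ℂ] H)) (z : Circle) : H →L[ℂ] H :=
  (eigenspace U z).starProjection

/-- `σ_pp(U)`: the set of the points of the unit circle that are eigenvalues of `U`. -/
def pointSpectrum (U : unitary (H →L[ℂ] H)) : Set Circle :=
  {z | Module.End.HasEigenvalue ((U : H →L[ℂ] H) : Module.End ℂ H) (z : ℂ)}

/-- The Cesàro mean `(1/N) ∑_{n=0}^{N-1} U^n A U^{-n}`. -/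
def cesaroMean (U : unitary (H →L[ℂ] H)) (A : H →L[ℂ] H) (N : ℕ) : H →L[ℂ] H :=
  (1 / (N : ℂ)) • ∑ n ∈ Finset.range N,
    ((U ^ (n : ℤ) : unitary (H →L[ℂ] H)) : H →L[ℂ] H) * A *
      ((U ^ (-(n : ℤ)) : unitary (H →L[ℂ] H)) : H →L[ℂ] H)

/-- The finite partial sum `∑_{z ∈ F} E_z A E_z`, for a finite set `F` of eigenvalues of `U`. -/
def partialSum (U : unitary (H →L[ℂ] H)) (A : H →L[ℂ] H)
    (F : Finset (pointSpectrum U)) : H →L[ℂ] H :=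
  ∑ z ∈ F, eigenProj U z * A * eigenProj U z

/-- Convergence of a family of bounded operators in the strong operator topology, which
Mathlib calls the topology of pointwise convergence. -/
def TendstoSOT {ι : Type*} (B : ι → H →L[ℂ] H) (l : Filter ι) (S : H →L[ℂ] H) : Prop :=
  Tendsto (fun i => ContinuousLinearMap.toPointwiseConvergenceCLM ℂ (RingHom.id ℂ) H H (B i)) l
    (𝓝 (ContinuousLinearMap.toPointwiseConvergenceCLM ℂ (RingHom.id ℂ) H H S))

/-- Convergence of a family of bounded operators in the weak operator topology. -/
def TendstoWOT {ι : Type*} (B : ι → H →L[ℂ] H) (l : Filter ι) (S : H →L[ℂ] H) : Prop :=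
  Tendsto (fun i => ContinuousLinearMapWOT.ofCLM (B i)) l (𝓝 (ContinuousLinearMapWOT.ofCLM S))

end UnitaryErgodic

end

/-! The means in fact converge strongly. They are bounded by `‖A‖`, so the vectors on which they
converge to `S` form a closed subspace, and it suffices to treat eigenvectors of `U` and vectors
orthogonal to all of them. If `U x = z x`, then `U^n A U^{-n} x = (z⁻¹ U)^n A x`, and von Neumann's
mean ergodic theorem gives the limit `E_z A x`. If `x` is orthogonal to all eigenvectors, then `S x
= 0`, and the norm of the mean is at most the mean of `‖A U^{-n} x‖`. Compactness of `A` reduces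
this to finitely many coefficients `⟪U^{-n} x, y⟫`, which vanish in quadratic mean (a Wiener-type
lemma, `tendsto_mean_norm_inner_sq`). Its proof needs no spectral measure: a weak limit `T` of the
means of the rank one operators on the orbit is positive, of finite trace, and commutes with `V`. If
`T ≠ 0`, it has a finite-dimensional `V`-invariant eigenspace, hence an eigenvector of `V` there;
but `T` kills every eigenvector of `V`. -/

open scoped ComplexConjugate

/-! ### Weak limits and compactness of positive trace class operators -/

/-- A bounded family of operators on a Hilbert space converges weakly along any ultrafilter. -/
theorem ContinuousLinearMap.exists_tendsto_inner_ultrafilter {H : Type*} [NormedAddCommGroup H]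
    [InnerProductSpace ℂ H] [CompleteSpace H] {ι : Type*} (𝒰 : Ultrafilter ι) (C : ι → H →L[ℂ] H)
    {M : ℝ} (hC : ∀ i, ‖C i‖ ≤ M) :
    ∃ T : H →L[ℂ] H, ∀ v w : H,
      Tendsto (fun i => inner ℂ (C i v) w) 𝒰 (𝓝 (inner ℂ (T v) w)) := by
  have hb : ∀ v w i, ‖inner ℂ (C i v) w‖ ≤ M * ‖v‖ * ‖w‖ := fun v w i =>
    (norm_inner_le_norm _ _).trans <| by
      gcongr
      exact (C i).le_of_opNorm_le (hC i) v
  have hex : ∀ v w, ∃ l : ℂ, ‖l‖ ≤ M * ‖v‖ * ‖w‖ ∧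
      Tendsto (fun i => inner ℂ (C i v) w) 𝒰 (𝓝 l) := by
    intro v w
    obtain ⟨l, hl, h⟩ := (isCompact_closedBall (0 : ℂ) (M * ‖v‖ * ‖w‖)).ultrafilter_le_nhds
      (𝒰.map fun i => inner ℂ (C i v) w) (by
        rw [le_principal_iff]
        exact mem_map.2 (Eventually.of_forall fun i => by simpa using hb v w i))
    exact ⟨l, by simpa using hl, h⟩
  choose L hLb hL using hex
  -- Uniqueness of limits makes `L` sesquilinear; its bound `M` lets the Riesz representation turn
  -- it into an operator.
  let B₀ : H →ₗ⋆[ℂ] H →ₗ[ℂ] ℂ := LinearMap.mk₂'ₛₗ _ _ L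
    (fun v₁ v₂ w => tendsto_nhds_unique (hL _ _) (by
      simpa [inner_add_left] using (hL v₁ w).add (hL v₂ w)))
    (fun c v w => tendsto_nhds_unique (hL _ _) (by
      simpa [inner_smul_left, mul_comm] using (hL v w).const_mul (conj c)))
    (fun v w₁ w₂ => tendsto_nhds_unique (hL _ _) (by
      simpa [inner_add_right] using (hL v w₁).add (hL v w₂)))
    (fun c v w => tendsto_nhds_unique (hL _ _) (by
      simpa [inner_smul_right] using (hL v w).const_mul c))
  refine ⟨InnerProductSpace.continuousLinearMapOfBilin (B₀.mkContinuous₂ M hLb), fun v w => ?_⟩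
  rw [InnerProductSpace.continuousLinearMapOfBilin_apply]
  exact hL v w

/-- A positive operator whose diagonal sums over finite orthonormal families are bounded
(that is, a positive trace class operator) is compact. -/
theorem ContinuousLinearMap.IsPositive.isCompactOperator_of_sum_le {H : Type*}
    [NormedAddCommGroup H] [InnerProductSpace ℂ H] [CompleteSpace H] {T : H →L[ℂ] H}
    (hT : T.IsPositive) {M : ℝ}
    (hM : ∀ (k : ℕ) (e : Fin k → H), Orthonormal ℂ e → ∑ i, (inner ℂ (T (e i)) (e i)).re ≤ M) :
    IsCompactOperator T := by
  -- The square root turns the quadratic form of `T` into a norm: `⟪T u, u⟫ = ‖R u‖ ^ 2`.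
  set R := CFC.sqrt T with hR
  have hT0 : 0 ≤ T := (ContinuousLinearMap.nonneg_iff_isPositive T).2 hT
  have hRR : R * R = T := CFC.sqrt_mul_sqrt_self T hT0
  have hRpos : R.IsPositive :=
    (ContinuousLinearMap.nonneg_iff_isPositive R).1 (CFC.sqrt_nonneg T)
  have hRnorm : ∀ u, ‖R u‖ ^ 2 = (inner ℂ (T u) u).re := by
    intro u
    rw [← hRR, mul_apply_eq_comp, hRpos.inner_left_eq_inner_right,
      inner_self_eq_norm_sq_to_K]
    norm_cast
  let 𝒮 : Set ℝ := {r | ∃ (k : ℕ) (e : Fin k → H), Orthonormal ℂ e ∧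
    r = ∑ i, (inner ℂ (T (e i)) (e i)).re}
  have h𝒮b : BddAbove 𝒮 := ⟨M, by rintro _ ⟨k, e, he, rfl⟩; exact hM k e he⟩
  have h𝒮n : 𝒮.Nonempty := ⟨_, 0, fun i => i.elim0, ⟨fun i => i.elim0, fun i => i.elim0⟩, rfl⟩
  refine (isClosed_setOfPred_isCompactOperator (𝕜₁ := ℂ) (𝕜₂ := ℂ) (σ₁₂ := RingHom.id ℂ) (M₁ := H)
    (M₂ := H)).closure_subset (Metric.mem_closure_iff.2 fun ε hε => ?_)
  obtain ⟨δ, hδ, hδε⟩ : ∃ δ > 0, ‖R‖ * δ < ε :=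
    ⟨ε / (‖R‖ + 1), by positivity, by
      rw [mul_div_assoc', div_lt_iff₀ (by positivity)]
      nlinarith [norm_nonneg R]⟩
  -- The family is within `δ ^ 2` of the supremum, so one more unit vector orthogonal to it adds at
  -- most `δ ^ 2`. Hence `R` is at most `δ` on `Wᗮ`, and `T` is close to a finite rank operator.
  obtain ⟨_, ⟨k, e, he, rfl⟩, hlt⟩ := exists_lt_of_lt_csSup h𝒮n
    (show sSup 𝒮 - δ ^ 2 < sSup 𝒮 by nlinarith)
  let W : Submodule ℂ H := Submodule.span ℂ (Set.range e)
  have hW : FiniteDimensional ℂ W := FiniteDimensional.span_of_finite ℂ (Set.finite_range e)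
  have hunit : ∀ u ∈ Wᗮ, ‖u‖ = 1 → ‖R u‖ ^ 2 ≤ δ ^ 2 := by
    intro u hu hu1
    have hon : Orthonormal ℂ (Matrix.vecCons u e) := by
      rw [orthonormal_vecCons_iff]
      exact ⟨hu1, fun i => Submodule.inner_left_of_mem_orthogonal
        (Submodule.subset_span (Set.mem_range_self i)) hu, he⟩
    have := le_csSup h𝒮b ⟨k + 1, _, hon, rfl⟩
    rw [Fin.sum_univ_succ] at this
    simp only [Matrix.cons_val_zero, Matrix.cons_val_succ] at this
    rw [hRnorm]
    linarith
  have hperp : ∀ u ∈ Wᗮ, ‖R u‖ ≤ δ * ‖u‖ := by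
    intro u hu
    rcases eq_or_ne u 0 with rfl | hu0
    · simp
    have h1 := hunit _ (Wᗮ.smul_mem ((‖u‖ : ℂ)⁻¹) hu) (by simp [norm_smul, hu0])
    have h2 := abs_le_of_sq_le_sq h1 hδ.le
    rw [map_smul, norm_smul, norm_inv, Complex.norm_real, norm_norm, abs_of_nonneg (by positivity),
      inv_mul_le_iff₀ (by positivity)] at h2
    linarith
  refine ⟨T ∘L W.starProjection, ?_, ?_⟩
  · have h1 : IsCompactOperator W.orthogonalProjectionOnto := by
      have := FiniteDimensional.proper ℂ W
      exact isCompactOperator_of_locallyCompactSpace_dom W.orthogonalProjectionOnto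
    exact h1.clm_comp (T ∘L W.subtypeL)
  · rw [dist_eq_norm]
    refine lt_of_le_of_lt (ContinuousLinearMap.opNorm_le_bound _ (by positivity) fun v => ?_) hδε
    have hv : v - W.starProjection v ∈ Wᗮ := W.sub_starProjection_mem_orthogonal v
    have hn : ‖v - W.starProjection v‖ ≤ ‖v‖ := by
      have := Wᗮ.norm_starProjection_apply_le v
      rwa [Submodule.starProjection_orthogonal'] at this
    calc ‖(T - T ∘L W.starProjection) v‖ = ‖R (R (v - W.starProjection v))‖ := by
          rw [← mul_apply_eq_comp, hRR]; simp
      _ ≤ ‖R‖ * ‖R (v - W.starProjection v)‖ := R.le_opNorm _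
      _ ≤ ‖R‖ * (δ * ‖v‖) := by
          gcongr
          exact (hperp _ hv).trans (by gcongr)
      _ = ‖R‖ * δ * ‖v‖ := by ring

/-! ### Wiener-type lemma: orbits orthogonal to all eigenvectors -/

/-- The Cesàro means of the rank one operators attached to the orbit of `x`. -/
noncomputable def orbitMean {H : Type*} [NormedAddCommGroup H] [InnerProductSpace ℂ H]
    (V : H →L[ℂ] H) (x : H) (N : ℕ) : H →L[ℂ] H :=
  (N : ℂ)⁻¹ • ∑ n ∈ Finset.range N, InnerProductSpace.rankOne ℂ ((V ^ n) x) ((V ^ n) x)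

section OrbitMean

variable {H : Type*} [NormedAddCommGroup H] [InnerProductSpace ℂ H] {V : H →L[ℂ] H}

theorem inner_orbitMean_apply (V : H →L[ℂ] H) (x : H) (N : ℕ) (v w : H) :
    inner ℂ (orbitMean V x N v) w =
      (N : ℂ)⁻¹ * ∑ n ∈ Finset.range N, inner ℂ v ((V ^ n) x) * inner ℂ ((V ^ n) x) w := by
  rw [orbitMean, smul_apply, inner_smul_left, sum_apply,
    sum_inner, map_inv₀, Complex.conj_natCast]
  simp only [InnerProductSpace.inner_left_rankOne_apply]

theorem inner_orbitMean_self (V : H →L[ℂ] H) (x : H) (N : ℕ) (v : H) :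
    inner ℂ (orbitMean V x N v) v =
      (((N : ℝ)⁻¹ * ∑ n ∈ Finset.range N, ‖inner ℂ ((V ^ n) x) v‖ ^ 2 : ℝ) : ℂ) := by
  rw [inner_orbitMean_apply]
  push_cast
  congr 1
  refine Finset.sum_congr rfl fun n _ => ?_
  rw [← inner_conj_symm v, RCLike.conj_mul]
  rfl

theorem norm_pow_apply_of_inner_map_map (hV : ∀ a b, inner ℂ (V a) (V b) = inner ℂ a b) (n : ℕ)
    (x : H) : ‖(V ^ n) x‖ = ‖x‖ := by
  have h1 : ∀ a, ‖V a‖ = ‖a‖ := fun a => by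
    rw [@norm_eq_sqrt_re_inner ℂ, @norm_eq_sqrt_re_inner ℂ _ _ _ _ a, hV]
  induction n with
  | zero => simp
  | succ n ih => rw [pow_succ', mul_apply_eq_comp, h1, ih]

theorem norm_orbitMean_le (hV : ∀ a b, inner ℂ (V a) (V b) = inner ℂ a b) (x : H) (N : ℕ) :
    ‖orbitMean V x N‖ ≤ ‖x‖ ^ 2 := by
  rcases Nat.eq_zero_or_pos N with rfl | hN
  · simp [orbitMean]
  rw [orbitMean, norm_smul, norm_inv, Complex.norm_natCast, inv_mul_le_iff₀ (by positivity)]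
  refine (norm_sum_le_of_le _ fun n _ => ?_).trans_eq (by rw [Finset.sum_const, Finset.card_range,
    nsmul_eq_mul])
  rw [InnerProductSpace.norm_rankOne, norm_pow_apply_of_inner_map_map hV, sq]

/-- The difference telescopes to two boundary terms divided by `N`. Weak limits of the means
therefore commute with `V`. -/
theorem tendsto_inner_orbitMean_map_sub (hV : ∀ a b, inner ℂ (V a) (V b) = inner ℂ a b)
    (x v w : H) :
    Tendsto (fun N => inner ℂ (orbitMean V x N (V v)) (V w) - inner ℂ (orbitMean V x N v) w)
      atTop (𝓝 0) := by
  let g : ℕ → ℂ := fun n => inner ℂ (V v) ((V ^ n) x) * inner ℂ ((V ^ n) x) (V w)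
  have hg : ∀ n, ‖g n‖ ≤ ‖V v‖ * ‖x‖ * (‖x‖ * ‖V w‖) := fun n => by
    rw [norm_mul]
    have h := norm_pow_apply_of_inner_map_map hV n x
    gcongr
    · exact (norm_inner_le_norm _ _).trans_eq (by rw [h])
    · exact (norm_inner_le_norm _ _).trans_eq (by rw [h])
  have heq : ∀ N, inner ℂ (orbitMean V x N (V v)) (V w) - inner ℂ (orbitMean V x N v) w =
      (N : ℂ)⁻¹ * (g 0 - g N) := fun N => by
    have h1 : ∑ n ∈ Finset.range N, inner ℂ v ((V ^ n) x) * inner ℂ ((V ^ n) x) w =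
        ∑ n ∈ Finset.range N, g (n + 1) :=
      Finset.sum_congr rfl fun n _ => by simp only [g, pow_succ', mul_apply_eq_comp, hV]
    have h2 := Finset.sum_range_succ g N
    rw [Finset.sum_range_succ'] at h2
    rw [inner_orbitMean_apply, inner_orbitMean_apply, h1, ← mul_sub]
    congr 1
    linear_combination -h2
  simp_rw [heq]
  refine squeeze_zero_norm (a := fun N : ℕ => (N : ℝ)⁻¹ *
    (2 * (‖V v‖ * ‖x‖ * (‖x‖ * ‖V w‖)))) (fun N => ?_) ?_
  · rw [norm_mul, norm_inv, Complex.norm_natCast]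
    gcongr
    linarith [norm_sub_le (g 0) (g N), hg 0, hg N]
  · simpa using (tendsto_inv_atTop_nhds_zero_nat (𝕜 := ℝ)).mul_const _

/-- If `x` is orthogonal to all eigenvectors of a unitary operator `V`, then the matrix
coefficients `⟪V ^ n x, y⟫` converge to zero in quadratic mean. -/
theorem tendsto_mean_norm_inner_sq [CompleteSpace H]
    (hV : ∀ a b, inner ℂ (V a) (V b) = inner ℂ a b) (hVs : Function.Surjective V) {x : H}
    (hx : ∀ (c : ℂ) (v : H), V v = c • v → inner ℂ v x = 0) (y : H) :
    Tendsto (fun N : ℕ => (N : ℝ)⁻¹ * ∑ n ∈ Finset.range N, ‖inner ℂ ((V ^ n) x) y‖ ^ 2)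
      atTop (𝓝 0) := by
  -- Along each ultrafilter finer than `atTop` a weak limit `T` exists; the claim becomes `T = 0`.
  rw [tendsto_iff_ultrafilter]
  intro 𝒰 h𝒰
  obtain ⟨T, hT⟩ := ContinuousLinearMap.exists_tendsto_inner_ultrafilter 𝒰 (orbitMean V x)
    (norm_orbitMean_le hV x)
  have hTself : ∀ v, Tendsto (fun N : ℕ => (N : ℝ)⁻¹ *
      ∑ n ∈ Finset.range N, ‖inner ℂ ((V ^ n) x) v‖ ^ 2) 𝒰 (𝓝 (inner ℂ (T v) v).re) := by
    intro v
    have := (Complex.continuous_re.tendsto _).comp (hT v v)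
    refine this.congr fun N => ?_
    simp only [Function.comp_apply, inner_orbitMean_self, Complex.ofReal_re]
  have hTpos : T.IsPositive := by
    rw [ContinuousLinearMap.isPositive_iff_complex]
    intro v
    refine ⟨?_, ge_of_tendsto' (hTself v) fun N => by positivity⟩
    refine tendsto_nhds_unique (f := fun N => inner ℂ (orbitMean V x N v) v) (l := 𝒰) ?_ (hT v v)
    simp_rw [inner_orbitMean_self]
    exact (Complex.continuous_ofReal.tendsto _).comp (hTself v)
  have hcomm : ∀ v, T (V v) = V (T v) := by
    intro v
    refine ext_inner_right ℂ fun w => ?_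
    obtain ⟨w, rfl⟩ := hVs w
    rw [hV, ← sub_eq_zero]
    exact tendsto_nhds_unique ((hT (V v) (V w)).sub (hT v w))
      ((tendsto_inner_orbitMean_map_sub hV x v w).mono_left h𝒰)
  have hcpt : IsCompactOperator T := by
    refine hTpos.isCompactOperator_of_sum_le (M := ‖x‖ ^ 2) fun k e he => ?_
    refine le_of_tendsto' (tendsto_finsetSum _ fun i _ => hTself (e i)) fun N => ?_
    rcases Nat.eq_zero_or_pos N with rfl | hN
    · simp
    rw [← Finset.mul_sum, Finset.sum_comm, inv_mul_le_iff₀ (by positivity)]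
    refine (Finset.sum_le_sum fun n _ => ?_).trans_eq (b := ∑ n ∈ Finset.range N, ‖x‖ ^ 2)
      (by rw [Finset.sum_const, Finset.card_range, nsmul_eq_mul])
    -- Bessel's inequality for each orbit point bounds the trace of `T` by `‖x‖ ^ 2`.
    have := he.sum_inner_products_le ((V ^ n) x) (s := Finset.univ)
    rw [norm_pow_apply_of_inner_map_map hV] at this
    simpa only [norm_inner_symm] using this
  have hT0 : T = 0 := by
    rw [← ContinuousLinearMap.eq_zero_of_forall_hasEigenvalue_eq_zero hcpt hTpos.isSymmetric]
    intro μ hμ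
    by_contra hμ0
    have hfin := ContinuousLinearMap.finite_dimensional_eigenspace hcpt μ hμ0
    have hinv : ∀ v ∈ Module.End.eigenspace T.toLinearMap μ,
        (V : H →ₗ[ℂ] H) v ∈ Module.End.eigenspace T.toLinearMap μ := by
      intro v hv
      rw [Module.End.mem_eigenspace_iff] at hv ⊢
      simp only [ContinuousLinearMap.coe_coe] at hv ⊢
      rw [hcomm, hv, map_smul]
    have : Nontrivial (Module.End.eigenspace T.toLinearMap μ) :=
      Submodule.nontrivial_iff_ne_bot.2 hμ
    obtain ⟨c, hc⟩ := Module.End.exists_eigenvalue ((V : H →ₗ[ℂ] H).restrict hinv)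
    obtain ⟨⟨v, hvT⟩, hv⟩ := hc.exists_hasEigenvector
    have hv0 : v ≠ 0 := fun h => hv.2 (Subtype.ext h)
    have hVv : V v = c • v := congrArg Subtype.val hv.apply_eq_smul
    have hc0 : c ≠ 0 := by
      rintro rfl
      have := hV v v
      rw [hVv] at this
      rw [zero_smul, inner_zero_left, eq_comm, inner_self_eq_zero] at this
      exact hv0 this
    -- The orthogonal complement of an eigenvector of the isometry `V` is `V`-invariant, so the
    -- whole orbit of `x` stays in it.
    have hort : ∀ n, inner ℂ v ((V ^ n) x) = 0 := by
      intro n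
      induction n with
      | zero => simpa using hx c v hVv
      | succ n ih =>
        have h := hV v ((V ^ n) x)
        rw [ih, hVv, inner_smul_left] at h
        rw [pow_succ', mul_apply_eq_comp]
        simpa [hc0] using h
    have hTv : T v = 0 := by
      refine ext_inner_right ℂ fun w => ?_
      rw [inner_zero_left]
      refine tendsto_nhds_unique (hT v w) ?_
      simp only [inner_orbitMean_apply, hort, zero_mul, Finset.sum_const_zero, mul_zero,
        tendsto_const_nhds]
    rw [Module.End.mem_eigenspace_iff] at hvT
    simp only [ContinuousLinearMap.coe_coe, hTv] at hvT
    exact (smul_ne_zero hμ0 hv0) hvT.symm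
  simpa [hT0] using hTself y

end OrbitMean

/-! ### Compact operators along such orbits -/

/-- By Cauchy–Schwarz, the square of a mean is at most the mean of the squares. -/
theorem tendsto_mean_of_tendsto_mean_sq {a : ℕ → ℝ} (ha : ∀ n, 0 ≤ a n)
    (h : Tendsto (fun N : ℕ => (N : ℝ)⁻¹ * ∑ n ∈ Finset.range N, a n ^ 2) atTop (𝓝 0)) :
    Tendsto (fun N : ℕ => (N : ℝ)⁻¹ * ∑ n ∈ Finset.range N, a n) atTop (𝓝 0) := by
  have h0 := (Real.continuous_sqrt.tendsto _).comp h
  rw [Real.sqrt_zero] at h0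
  refine squeeze_zero (fun N => mul_nonneg (by positivity) (Finset.sum_nonneg fun n _ => ha n))
    (fun N => Real.le_sqrt_of_sq_le ?_) h0
  rcases Nat.eq_zero_or_pos N with rfl | hN
  · simp
  have h1 := sq_sum_le_card_mul_sum_sq (s := Finset.range N) (f := a)
  rw [Finset.card_range] at h1
  calc ((N : ℝ)⁻¹ * ∑ n ∈ Finset.range N, a n) ^ 2
      = (N : ℝ)⁻¹ * (N : ℝ)⁻¹ * (∑ n ∈ Finset.range N, a n) ^ 2 := by ring
    _ ≤ (N : ℝ)⁻¹ * (N : ℝ)⁻¹ * (N * ∑ n ∈ Finset.range N, a n ^ 2) := by gcongr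
    _ = (N : ℝ)⁻¹ * ∑ n ∈ Finset.range N, a n ^ 2 := by field_simp

/-- A compact operator tends to zero in mean along the orbit of a vector that is orthogonal to
all eigenvectors of a unitary operator. -/
theorem IsCompactOperator.tendsto_mean_norm_apply {H : Type*} [NormedAddCommGroup H]
    [InnerProductSpace ℂ H] [CompleteSpace H] {A V : H →L[ℂ] H} (hA : IsCompactOperator A)
    (hV : ∀ a b, inner ℂ (V a) (V b) = inner ℂ a b) (hVs : Function.Surjective V) {x : H}
    (hx : ∀ (c : ℂ) (v : H), V v = c • v → inner ℂ v x = 0) :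
    Tendsto (fun N : ℕ => (N : ℝ)⁻¹ * ∑ n ∈ Finset.range N, ‖A ((V ^ n) x)‖) atTop (𝓝 0) := by
  refine tendsto_mean_of_tendsto_mean_sq (fun n => norm_nonneg _) ?_
  have hn := norm_pow_apply_of_inner_map_map hV
  rw [Metric.tendsto_atTop]
  intro ε hε
  obtain ⟨δ, hδ, hδε⟩ : ∃ δ > 0, ‖A‖ * ‖x‖ * δ < ε / 2 :=
    ⟨ε / 2 / (‖A‖ * ‖x‖ + 1), by positivity, by
      rw [mul_div_assoc', div_lt_iff₀ (by positivity)]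
      nlinarith [show 0 ≤ ‖A‖ * ‖x‖ by positivity]⟩
  have htb : TotallyBounded (A '' Metric.closedBall 0 ‖x‖) :=
    (hA.isCompact_closure_image_closedBall (f := (A : H →ₗ[ℂ] H)) ‖x‖).totallyBounded.subset
      subset_closure
  obtain ⟨t, ht, htc⟩ := Metric.totallyBounded_iff.1 htb δ hδ
  -- For a net point `y` within `δ` of `A u`, split `⟪A u, A u⟫` at `y` and move `A` to the other
  -- side. Summing over the whole net removes the dependence of `y` on `n`.
  have hpt : ∀ n, ‖A ((V ^ n) x)‖ ^ 2 ≤ ‖A‖ * ‖x‖ * δ +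
      ∑ y ∈ ht.toFinset, ‖inner ℂ ((V ^ n) x) (A.adjoint y)‖ := by
    intro n
    have hmem := htc (Set.mem_image_of_mem A
      (show (V ^ n) x ∈ Metric.closedBall 0 ‖x‖ by simpa using (hn n x).le))
    simp only [Set.mem_iUnion, Metric.mem_ball, dist_eq_norm] at hmem
    obtain ⟨y, hy, hyd⟩ := hmem
    set u := (V ^ n) x with hu
    have h1 : ‖A u‖ ≤ ‖A‖ * ‖x‖ := A.le_of_opNorm_le_of_le le_rfl (hn n x).le
    have h2 : ‖A u‖ ^ 2 ≤ ‖inner ℂ (A u) (A u - y)‖ + ‖inner ℂ (A u) y‖ := by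
      refine le_trans (le_of_eq ?_) (norm_add_le _ _)
      rw [← inner_add_right, sub_add_cancel, inner_self_eq_norm_sq_to_K]
      simp
    have h3 : ‖inner ℂ (A u) (A u - y)‖ ≤ ‖A‖ * ‖x‖ * δ :=
      (norm_inner_le_norm _ _).trans (by gcongr)
    have h4 : ‖inner ℂ (A u) y‖ ≤ ∑ y ∈ ht.toFinset, ‖inner ℂ u (A.adjoint y)‖ := by
      rw [← ContinuousLinearMap.adjoint_inner_right]
      exact Finset.single_le_sum (f := fun y => ‖inner ℂ u (A.adjoint y)‖)
        (fun _ _ => norm_nonneg _) (ht.mem_toFinset.2 hy)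
    linarith
  have hlim : Tendsto (fun N : ℕ => ∑ y ∈ ht.toFinset, (N : ℝ)⁻¹ *
      ∑ n ∈ Finset.range N, ‖inner ℂ ((V ^ n) x) (A.adjoint y)‖) atTop (𝓝 0) := by
    rw [← Finset.sum_const_zero (s := ht.toFinset) (ι := H)]
    exact tendsto_finsetSum _ fun y _ => tendsto_mean_of_tendsto_mean_sq (fun n => norm_nonneg _)
      (tendsto_mean_norm_inner_sq hV hVs hx _)
  obtain ⟨N₀, hN₀⟩ := eventually_atTop.1 (hlim.eventually_lt_const (half_pos hε))
  refine ⟨max N₀ 1, fun N hN => ?_⟩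
  have hNpos : (0 : ℝ) < N := by exact_mod_cast (le_max_right N₀ 1).trans hN
  have hlt := hN₀ N ((le_max_left _ _).trans hN)
  rw [Real.dist_0_eq_abs, abs_of_nonneg (by positivity)]
  calc (N : ℝ)⁻¹ * ∑ n ∈ Finset.range N, ‖A ((V ^ n) x)‖ ^ 2
      ≤ (N : ℝ)⁻¹ * ∑ n ∈ Finset.range N, (‖A‖ * ‖x‖ * δ +
        ∑ y ∈ ht.toFinset, ‖inner ℂ ((V ^ n) x) (A.adjoint y)‖) := by
        gcongr with n _
        exact hpt n
    _ = ‖A‖ * ‖x‖ * δ + ∑ y ∈ ht.toFinset, (N : ℝ)⁻¹ *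
        ∑ n ∈ Finset.range N, ‖inner ℂ ((V ^ n) x) (A.adjoint y)‖ := by
        rw [Finset.sum_add_distrib, Finset.sum_const, Finset.card_range, nsmul_eq_mul,
          Finset.sum_comm, mul_add, ← Finset.mul_sum, inv_mul_cancel_left₀ hNpos.ne']
    _ < ε := by linarith

/-! ### Eigenprojections and the strong sum of the diagonal blocks -/

namespace UnitaryErgodic

variable {H : Type*} [NormedAddCommGroup H] [InnerProductSpace ℂ H] [CompleteSpace H]
  (U : unitary (H →L[ℂ] H))

theorem mem_eigenspace_iff {U : unitary (H →L[ℂ] H)} {z : Circle} {x : H} :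
    x ∈ eigenspace U z ↔ (U : H →L[ℂ] H) x = (z : ℂ) • x :=
  Module.End.mem_eigenspace_iff

theorem orthogonalFamily_eigenspace :
    OrthogonalFamily ℂ (fun z : Circle => eigenspace U z) fun z => (eigenspace U z).subtypeₗᵢ := by
  rintro z w hzw ⟨x, hx⟩ ⟨y, hy⟩
  have h := ContinuousLinearMap.inner_map_map_of_mem_unitary U.2 x y
  rw [mem_eigenspace_iff.1 hx, mem_eigenspace_iff.1 hy, inner_smul_left, inner_smul_right,
    ← Circle.coe_inv_eq_conj, ← mul_assoc, ← Circle.coe_mul] at h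
  by_contra h0
  have h1 := mul_right_cancel₀ h0 (h.trans (one_mul _).symm)
  rw [Circle.coe_eq_one, inv_mul_eq_one] at h1
  exact hzw h1

/-- Bessel's inequality: `p = ∑ E_z x` satisfies `‖p‖ ^ 2 = ⟪p, x⟫ ≤ ‖p‖ ‖x‖`. -/
theorem sum_norm_eigenProj_sq_le (F : Finset Circle) (x : H) :
    ∑ z ∈ F, ‖eigenProj U z x‖ ^ 2 ≤ ‖x‖ ^ 2 := by
  have h1 := (orthogonalFamily_eigenspace U).norm_sum
    (fun z => (eigenspace U z).orthogonalProjectionOnto x) F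
  have h2 : ∑ z ∈ F, ‖eigenProj U z x‖ ^ 2 = ‖∑ z ∈ F, eigenProj U z x‖ ^ 2 := h1.symm
  have h3 : ∑ z ∈ F, ‖eigenProj U z x‖ ^ 2 = (inner ℂ (∑ z ∈ F, eigenProj U z x) x).re := by
    rw [sum_inner, Complex.re_sum]
    refine Finset.sum_congr rfl fun z _ => ?_
    have := (eigenspace U z).inner_starProjection_left_eq_right (eigenProj U z x) x
    rw [eigenProj, Submodule.starProjection_eq_self_iff.2
      ((eigenspace U z).starProjection_apply_mem x), inner_self_eq_norm_sq_to_K] at this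
    rw [eigenProj, this]
    norm_cast
  have h4 : (inner ℂ (∑ z ∈ F, eigenProj U z x) x).re ≤ ‖∑ z ∈ F, eigenProj U z x‖ * ‖x‖ :=
    re_inner_le_norm (𝕜 := ℂ) _ _
  rw [← h3, h2] at h4
  rw [h2]
  nlinarith [norm_nonneg (∑ z ∈ F, eigenProj U z x), norm_nonneg x,
    sq_nonneg (‖∑ z ∈ F, eigenProj U z x‖ - ‖x‖)]

theorem sum_norm_eigenProj_conj_sq_le (A : H →L[ℂ] H) (F : Finset (pointSpectrum U)) (x : H) :
    ∑ z ∈ F, ‖eigenProj U z (A (eigenProj U z x))‖ ^ 2 ≤ (‖A‖ * ‖x‖) ^ 2 := by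
  calc ∑ z ∈ F, ‖eigenProj U z (A (eigenProj U z x))‖ ^ 2
      ≤ ∑ z ∈ F, ‖A‖ ^ 2 * ‖eigenProj U z x‖ ^ 2 := by
        refine Finset.sum_le_sum fun z _ => ?_
        rw [← mul_pow]
        gcongr
        exact ((eigenspace U z).norm_starProjection_apply_le _).trans (A.le_opNorm _)
    _ = ‖A‖ ^ 2 * ∑ z ∈ F.map (Function.Embedding.subtype _), ‖eigenProj U z x‖ ^ 2 := by
        rw [← Finset.mul_sum, Finset.sum_map]
        rfl
    _ ≤ ‖A‖ ^ 2 * ‖x‖ ^ 2 := by gcongr; exact sum_norm_eigenProj_sq_le U _ x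
    _ = (‖A‖ * ‖x‖) ^ 2 := by ring

theorem partialSum_apply (A : H →L[ℂ] H) (F : Finset (pointSpectrum U)) (x : H) :
    partialSum U A F x = ∑ z ∈ F, eigenProj U z (A (eigenProj U z x)) := by
  simp [partialSum]

theorem orthogonalFamily_pointSpectrum :
    OrthogonalFamily ℂ (fun z : pointSpectrum U => eigenspace U (z : Circle))
      fun z => (eigenspace U (z : Circle)).subtypeₗᵢ :=
  (orthogonalFamily_eigenspace U).comp Subtype.val_injective

theorem norm_partialSum_le (A : H →L[ℂ] H) (F : Finset (pointSpectrum U)) :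
    ‖partialSum U A F‖ ≤ ‖A‖ := by
  refine ContinuousLinearMap.opNorm_le_bound _ (norm_nonneg _) fun x => ?_
  refine le_of_sq_le_sq ?_ (by positivity)
  rw [partialSum_apply]
  exact ((orthogonalFamily_pointSpectrum U).norm_sum (fun z =>
    (eigenspace U (z : Circle)).orthogonalProjectionOnto (A (eigenProj U z x))) F).trans_le
    (sum_norm_eigenProj_conj_sq_le U A F x)

/-- The terms are pairwise orthogonal, so summability reduces to that of their squared norms. -/
theorem summable_eigenProj_conj (A : H →L[ℂ] H) (x : H) :
    Summable fun z : pointSpectrum U => eigenProj U z (A (eigenProj U z x)) :=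
  ((orthogonalFamily_pointSpectrum U).summable_iff_norm_sq_summable (fun z =>
    (eigenspace U (z : Circle)).orthogonalProjectionOnto (A (eigenProj U z x)))).2
    (summable_of_sum_le (fun _ => by positivity)
      fun F => sum_norm_eigenProj_conj_sq_le U A F x)

/-- For every bounded `A` the sum of `E_z A E_z` over the eigenvalues converges strongly. -/
theorem exists_hasSum_eigenProj_conj (A : H →L[ℂ] H) :
    ∃ S : H →L[ℂ] H, ∀ x,
      HasSum (fun z : pointSpectrum U => eigenProj U z (A (eigenProj U z x))) (S x) := by
  refine ⟨ContinuousLinearMap.ofTendstoOfBoundedRange (l := atTop)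
    (fun x => ∑' z : pointSpectrum U, eigenProj U z (A (eigenProj U z x))) (partialSum U A)
    (tendsto_pi_nhds.2 fun x => ?_)
    (isBounded_iff_forall_norm_le.2 ⟨‖A‖, Set.forall_mem_range.2 (norm_partialSum_le U A)⟩),
    fun x => (summable_eigenProj_conj U A x).hasSum⟩
  simp_rw [partialSum_apply]
  exact (summable_eigenProj_conj U A x).hasSum

/-! ### Cesàro means of the conjugates of `A` -/

theorem inv_apply_apply (x : H) :
    ((U⁻¹ : unitary (H →L[ℂ] H)) : H →L[ℂ] H) ((U : H →L[ℂ] H) x) = x := by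
  rw [← mul_apply_eq_comp, ← Submonoid.coe_mul, inv_mul_cancel]
  rfl

theorem apply_inv_apply (x : H) :
    (U : H →L[ℂ] H) (((U⁻¹ : unitary (H →L[ℂ] H)) : H →L[ℂ] H) x) = x := by
  rw [← mul_apply_eq_comp, ← Submonoid.coe_mul, mul_inv_cancel]
  rfl

theorem inv_apply_of_mem_eigenspace {z : Circle} {x : H} (hx : x ∈ eigenspace U z) :
    ((U⁻¹ : unitary (H →L[ℂ] H)) : H →L[ℂ] H) x = ((z⁻¹ : Circle) : ℂ) • x := by
  have h := inv_apply_apply U x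
  rw [mem_eigenspace_iff.1 hx, map_smul] at h
  calc _ = ((z⁻¹ : Circle) : ℂ) • (z : ℂ) • ((U⁻¹ : unitary (H →L[ℂ] H)) : H →L[ℂ] H) x := by
        rw [smul_smul, ← Circle.coe_mul, inv_mul_cancel, Circle.coe_one, one_smul]
    _ = _ := by rw [h]

theorem inv_pow_apply_of_mem_eigenspace {z : Circle} {x : H} (hx : x ∈ eigenspace U z) (n : ℕ) :
    (((U⁻¹ : unitary (H →L[ℂ] H)) : H →L[ℂ] H) ^ n) x = ((z⁻¹ : Circle) : ℂ) ^ n • x := by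
  induction n with
  | zero => simp
  | succ n ih =>
    rw [pow_succ', mul_apply_eq_comp, ih, map_smul, inv_apply_of_mem_eigenspace U hx, smul_smul,
      pow_succ]

theorem cesaroMean_apply (A : H →L[ℂ] H) (N : ℕ) (x : H) :
    cesaroMean U A N x = (N : ℂ)⁻¹ • ∑ n ∈ Finset.range N, ((U : H →L[ℂ] H) ^ n)
      (A ((((U⁻¹ : unitary (H →L[ℂ] H)) : H →L[ℂ] H) ^ n) x)) := by
  simp only [cesaroMean, one_div, smul_apply, sum_apply, mul_apply_eq_comp, zpow_neg,
    zpow_natCast, ← inv_pow, SubmonoidClass.coe_pow]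

theorem norm_pow_apply (U : unitary (H →L[ℂ] H)) (n : ℕ) (x : H) :
    ‖((U : H →L[ℂ] H) ^ n) x‖ = ‖x‖ :=
  norm_pow_apply_of_inner_map_map (ContinuousLinearMap.inner_map_map_of_mem_unitary U.2) n x

theorem norm_cesaroMean_apply_le (A : H →L[ℂ] H) (N : ℕ) (x : H) :
    ‖cesaroMean U A N x‖ ≤ (N : ℝ)⁻¹ * ∑ n ∈ Finset.range N,
      ‖A ((((U⁻¹ : unitary (H →L[ℂ] H)) : H →L[ℂ] H) ^ n) x)‖ := by
  rw [cesaroMean_apply, norm_smul, norm_inv, Complex.norm_natCast]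
  gcongr
  exact norm_sum_le_of_le _ fun n _ => (norm_pow_apply U n _).le

theorem norm_cesaroMean_le (A : H →L[ℂ] H) (N : ℕ) : ‖cesaroMean U A N‖ ≤ ‖A‖ := by
  refine ContinuousLinearMap.opNorm_le_bound _ (norm_nonneg _) fun x => ?_
  rcases Nat.eq_zero_or_pos N with rfl | hN
  · simp only [cesaroMean_apply, Finset.range_zero, Finset.sum_empty, smul_zero, norm_zero]
    positivity
  refine (norm_cesaroMean_apply_le U A N x).trans ?_
  rw [inv_mul_le_iff₀ (by positivity)]
  refine (Finset.sum_le_sum (g := fun _ => ‖A‖ * ‖x‖) fun n _ => ?_).trans_eq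
    (by rw [Finset.sum_const, Finset.card_range, nsmul_eq_mul])
  exact A.le_of_opNorm_le_of_le le_rfl (norm_pow_apply U⁻¹ n x).le

/-- On an eigenvector the conjugation means converge by the mean ergodic theorem. -/
theorem tendsto_cesaroMean_of_mem_eigenspace (A : H →L[ℂ] H) {z : Circle} {x : H}
    (hx : x ∈ eigenspace U z) :
    Tendsto (fun N => cesaroMean U A N x) atTop (𝓝 (eigenProj U z (A x))) := by
  let f : H →L[ℂ] H := ((z⁻¹ : Circle) : ℂ) • (U : H →L[ℂ] H)
  have hf : ‖f‖ ≤ 1 := ContinuousLinearMap.opNorm_le_bound _ zero_le_one fun y => by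
    simp only [f, smul_apply, norm_smul, Circle.norm_coe, one_mul]
    exact (ContinuousLinearMap.norm_map_of_mem_unitary U.2 y).le
  have hK : f.eqLocus (1 : H →L[ℂ] H) = eigenspace U z := by
    ext y
    rw [mem_eigenspace_iff]
    change ((z⁻¹ : Circle) : ℂ) • (U : H →L[ℂ] H) y = y ↔ _
    rw [Circle.coe_inv, inv_smul_eq_iff₀ z.coe_ne_zero]
  -- The projection depends on an instance for its subspace, so equality of subspaces is transported
  -- with both of them variable.
  have hproj : ∀ (K L : Submodule ℂ H) [K.HasOrthogonalProjection] [L.HasOrthogonalProjection],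
      K = L → ∀ y, (K.orthogonalProjectionOnto y : H) = L.starProjection y := by
    rintro K _ _ _ rfl y
    rfl
  have hlim := f.tendsto_birkhoffAverage_orthogonalProjection hf (A x)
  rw [hproj _ (eigenspace U z) hK] at hlim
  refine hlim.congr fun N => ?_
  rw [cesaroMean_apply, birkhoffAverage, birkhoffSum]
  congr 1
  refine Finset.sum_congr rfl fun n _ => ?_
  rw [inv_pow_apply_of_mem_eigenspace U hx, map_smul, map_smul, ← smul_apply, ← smul_pow, id, ← FunLike.coe_pow_eq_iterate]

theorem eigenProj_apply_of_ne {z w : Circle} (hzw : w ≠ z) {x : H} (hx : x ∈ eigenspace U z) :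
    eigenProj U w x = 0 :=
  ((eigenspace U w).starProjection_apply_eq_zero_iff).2 <| (Submodule.mem_orthogonal _ _).2
    fun y hy => orthogonalFamily_eigenspace U hzw ⟨y, hy⟩ ⟨x, hx⟩

theorem hasSum_eigenProj_conj_of_mem_eigenspace (A : H →L[ℂ] H) {z : Circle} {x : H}
    (hx : x ∈ eigenspace U z) :
    HasSum (fun w : pointSpectrum U => eigenProj U w (A (eigenProj U w x)))
      (eigenProj U z (A x)) := by
  rcases eq_or_ne x 0 with rfl | hx0
  · simp
  have hz : z ∈ pointSpectrum U := Module.End.hasEigenvalue_of_hasEigenvector ⟨hx, hx0⟩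
  have hself : eigenProj U z x = x := Submodule.starProjection_eq_self_iff.2 hx
  have h := hasSum_single (f := fun w : pointSpectrum U => eigenProj U w (A (eigenProj U w x)))
    ⟨z, hz⟩ fun w hw => by
      rw [eigenProj_apply_of_ne U (fun h => hw (Subtype.ext h)) hx, map_zero, map_zero]
  simpa only [hself] using h

/-- For `v ≠ 0`, unitarity forces `‖c‖ = 1`, and `z = c⁻¹` serves. This lets the Wiener-type lemma
be applied to `U⁻¹`. -/
theorem exists_mem_eigenspace_of_inv_apply_eq_smul {c : ℂ} {v : H}
    (hv : ((U⁻¹ : unitary (H →L[ℂ] H)) : H →L[ℂ] H) v = c • v) :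
    ∃ z : Circle, v ∈ eigenspace U z := by
  rcases eq_or_ne v 0 with rfl | hv0
  · exact ⟨1, zero_mem _⟩
  have hc : ‖c‖ = 1 := by
    have h := ContinuousLinearMap.norm_map_of_mem_unitary (U⁻¹).2 v
    rw [hv, norm_smul] at h
    exact mul_right_cancel₀ (norm_ne_zero_iff.2 hv0) (h.trans (one_mul _).symm)
  have hc0 : c ≠ 0 := norm_ne_zero_iff.1 (by rw [hc]; exact one_ne_zero)
  refine ⟨⟨c⁻¹, mem_sphere_zero_iff_norm.2 (by rw [norm_inv, hc, inv_one])⟩,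
    mem_eigenspace_iff.2 ?_⟩
  have h := apply_inv_apply U v
  rw [hv, map_smul] at h
  exact (eq_inv_smul_iff₀ hc0).2 h

end UnitaryErgodic

/-! ### Conclusion by orthogonal decomposition -/

open UnitaryErgodic in
theorem proposition3p4 {H : Type*} [NormedAddCommGroup H] [InnerProductSpace ℂ H]
    [CompleteSpace H] (U : unitary (H →L[ℂ] H)) (A : H →L[ℂ] H) (hA : IsCompactOperator A) :
    ∃ S : H →L[ℂ] H,
      UnitaryErgodic.TendstoSOT (UnitaryErgodic.partialSum U A) Filter.atTop S ∧
      UnitaryErgodic.TendstoWOT (UnitaryErgodic.cesaroMean U A) Filter.atTop S := by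
  obtain ⟨S, hS⟩ := exists_hasSum_eigenProj_conj U A
  refine ⟨S, ?_, ?_⟩
  · refine PointwiseConvergenceCLM.tendsto_iff_forall_tendsto.2 fun x => ?_
    refine Tendsto.congr (fun F => (partialSum_apply U A F x).symm) (hS x)
  suffices h : ∀ x, Tendsto (fun N => cesaroMean U A N x) atTop (𝓝 (S x)) from
    ContinuousLinearMapWOT.tendsto_iff_forall_inner_apply_tendsto.2 fun x y =>
      Tendsto.inner tendsto_const_nhds (h x)
  let K : Submodule ℂ H := ⨆ z : Circle, eigenspace U z
  let D : Submodule ℂ H :=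
    { carrier := {x | Tendsto (fun N => cesaroMean U A N x) atTop (𝓝 (S x))}
      add_mem' := fun {x y} hx hy => by
        simpa only [Set.mem_ofPred_eq, map_add] using Tendsto.add hx hy
      zero_mem' := by simp
      smul_mem' := fun c x hx => by
        simpa only [Set.mem_ofPred_eq, map_smul] using Tendsto.const_smul hx c }
  -- The uniform bound `‖A‖` makes the means equicontinuous, so pointwise convergence to a
  -- continuous limit holds on a closed set.
  have hDclosed : IsClosed (D : Set H) :=
    (LipschitzWith.uniformEquicontinuous (fun N => cesaroMean U A N) ‖A‖₊ fun N =>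
      (cesaroMean U A N).lipschitz.weaken
        (norm_cesaroMean_le U A N)).equicontinuous.isClosed_setOfPred_tendsto S.continuous
  have hKD : K.topologicalClosure ≤ D := by
    refine K.topologicalClosure_minimal (iSup_le fun z x hx => ?_) hDclosed
    change Tendsto _ _ _
    rw [(hS x).unique (hasSum_eigenProj_conj_of_mem_eigenspace U A hx)]
    exact tendsto_cesaroMean_of_mem_eigenspace U A hx
  have horth : Kᗮ ≤ D := by
    intro x hx
    change Tendsto _ _ _
    have hmem : ∀ z, ∀ v ∈ eigenspace U z, inner ℂ v x = 0 := fun z v hv =>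
      (Submodule.mem_orthogonal _ _).1 hx v (Submodule.mem_iSup_of_mem z hv)
    have hproj : ∀ z, eigenProj U z x = 0 := fun z =>
      ((eigenspace U z).starProjection_apply_eq_zero_iff).2
        ((Submodule.mem_orthogonal _ _).2 (hmem z))
    have hSx : S x = 0 := (hS x).unique (by simpa only [hproj, map_zero] using hasSum_zero)
    rw [hSx]
    refine squeeze_zero_norm (norm_cesaroMean_apply_le U A · x) (hA.tendsto_mean_norm_apply
      (ContinuousLinearMap.inner_map_map_of_mem_unitary (U⁻¹).2)
      (fun y => ⟨_, inv_apply_apply U y⟩) fun c v hv => ?_)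
    obtain ⟨z, hz⟩ := exists_mem_eigenspace_of_inv_apply_eq_smul U hv
    exact hmem z v hz
  intro x
  have hcomplete : CompleteSpace K.topologicalClosure :=
    K.isClosed_topologicalClosure.completeSpace_coe
  obtain ⟨y, hy, w, hw, rfl⟩ := K.topologicalClosure.exists_add_mem_mem_orthogonal x
  exact D.add_mem (hKD hy) (horth (Submodule.orthogonal_le K.le_topologicalClosure hw))
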